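/- All graphs are finite and simple. A connected plane graph (with at least one edge) is described by its rotation system, i.e. the cyclic order of the edges around each vertex, in which every cycle of the graph separates the face on one side of each of its edges from the face on the other side. Every face is bounded by a closed boundary walk; the length of a face is the length of this walk (an edge with the face on both sides counts twice), and the face passes through a vertex $x$ as many times as $x$ occurs on this cyclic walk. A face is incident to $x$ (contains $x$) if it passes through $x$ at least once. A $1$-nearly platonic graph ($1$-NPG) is a connected regular plane graph in which all faces except exactly one, called the exceptional face, have the same length $d$, the length of the exceptional face being different from $d$. Let $G$ be a connected plane graph. (1) If $x$ is a cut-vertex of $G$, then some face of $G$ passes through $x$ at least twice and has length at least $4$. (2) If $x$ is a cut-vertex of $G$ and every face incident to $x$ has length less than $6$, then $x$ has a neighbour of degree $1$. (3) If $G$ is a $1$-NPG that has a cut-vertex, then its exceptional face has length at least $6$ and is incident to every cut-vertex of $G$. -/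

import Mathlib

namespace SimpleGraph

variable {V : Type*} {G : SimpleGraph V}

/-- `x` is a cut-vertex of `G`: deleting `x` separates two vertices of one component of `G`. -/
def IsCutVertex (G : SimpleGraph V) (x : V) : Prop :=
  ∃ u v : ({x}ᶜ : Set V), G.Reachable u v ∧ ¬ (G.induce ({x}ᶜ : Set V)).Reachable u v

/-- A rotation system on `G`: for every vertex, a cyclic order of all the darts (directed edges)
leaving that vertex. `next d` is the dart that follows `d` around the vertex `d.fst`.
Rotation systems on a connected graph are the combinatorial form of its drawings on closed oriented
surfaces in which every face is a disc. -/
structure RotationSystem (G : SimpleGraph V) where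
  next : Equiv.Perm G.Dart
  fst_next : ∀ d, (next d).fst = d.fst
  sameCycle : ∀ d e : G.Dart, d.fst = e.fst → next.SameCycle d e

namespace RotationSystem

/-- Face tracing: having walked along `d` from `d.fst` to `d.snd`, the boundary walk of the face
continues with the dart that follows the reversed dart in the rotation at `d.snd`. -/
def facePerm (R : RotationSystem G) : Equiv.Perm G.Dart :=
  (Function.Involutive.toPerm Dart.symm Dart.symm_involutive).trans R.next

/-- A face is a cycle of the face-tracing permutation; the darts of this cycle, in order, are the
steps of its closed boundary walk. (For a connected graph with at least one edge these are all
the faces.) -/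
def Face (R : RotationSystem G) : Type _ := Quotient (Equiv.Perm.SameCycle.setoid R.facePerm)

/-- The face whose boundary walk traverses the dart `d`; the face on the other side of
the same edge is `R.face d.symm`. -/
def face (R : RotationSystem G) (d : G.Dart) : R.Face :=
  Quotient.mk (Equiv.Perm.SameCycle.setoid R.facePerm) d

/-- The length (degree) of a face: the number of steps of its boundary walk, so that an edge with
the face on both sides counts twice. -/
noncomputable def length (R : RotationSystem G) (F : R.Face) : ℕ :=
  {d : G.Dart | R.face d = F}.ncard

/-- How often the boundary walk of the face `F` passes through the vertex `x`. -/
noncomputable def passes (R : RotationSystem G) (F : R.Face) (x : V) : ℕ :=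
  {d : G.Dart | R.face d = F ∧ d.fst = x}.ncard

/-- The vertex `x` lies on the boundary of the face `F`. -/
def Incident (R : RotationSystem G) (F : R.Face) (x : V) : Prop :=
  ∃ d : G.Dart, R.face d = F ∧ d.fst = x

/-- One can step from the face `F` to the face `F'` across an edge outside the set `C`. -/
def Crosses (R : RotationSystem G) (C : Set (Sym2 V)) (F F' : R.Face) : Prop :=
  ∃ d : G.Dart, d.edge ∉ C ∧ R.face d = F ∧ R.face d.symm = F'

/-- The rotation system describes a drawing in the plane (equivalently, on the sphere): every cycle
of the graph is a separating curve, that is, one cannot get from the face on one side of an edge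
of the cycle to the face on its other side without crossing the cycle. Among the closed
oriented surfaces only the sphere has this property. (Used for connected graphs.) -/
def IsPlane (R : RotationSystem G) : Prop :=
  ∀ (v : V) (c : G.Walk v v), c.IsCycle → ∀ d ∈ c.darts,
    ¬ Relation.ReflTransGen (R.Crosses {e | e ∈ c.edges}) (R.face d) (R.face d.symm)

/-- The plane graph given by `G` and `R` is a `k`-regular `t`-nearly platonic graph in which `d` is
the common length of the non-exceptional faces: it is (finite, simple,) connected, plane and
`k`-regular, and exactly `t` faces have a length different from `d`. -/
structure IsNearlyPlatonic [Fintype V] [DecidableRel G.Adj] (R : RotationSystem G)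
    (k d t : ℕ) : Prop where
  connected : G.Connected
  plane : R.IsPlane
  regular : G.IsRegularOfDegree k
  exceptional : {F : R.Face | R.length F ≠ d}.ncard = t

end RotationSystem

end SimpleGraph

/-! Turning around a cut-vertex `x`, the rotation leaves a part separated by `x`; the face at that
corner can only get back through `x`, so it passes `x` twice (`exists_two_le_passes`). Passes are at
least two steps apart, and at least three if no neighbour of `x` is a leaf, giving length at least
4, respectively 6. A regular graph with a cut-vertex has degree at least 3, hence no leaves, so
every cut-vertex lies on a face of length at least 6. Euler's inequality forces `d < 6`, so that
face is the exceptional one. -/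

namespace SimpleGraph

/-! ### Cut-vertices and degrees. -/

section Separation

variable {V : Type*} {G : SimpleGraph V} {x : V}

/-- A cut-vertex separates some set of vertices, containing some but not all of its neighbours,
from the remaining vertices. -/
theorem IsCutVertex.exists_separated_set (h : G.IsCutVertex x) :
    ∃ A : Set V, x ∉ A ∧ (∀ a ∈ A, ∀ b, G.Adj a b → b ∈ A ∨ b = x) ∧
      (∃ a ∈ A, G.Adj x a) ∧ ∃ b ∉ A, G.Adj x b := by
  obtain ⟨u, v, ⟨p⟩, huv⟩ := h
  let A : Set V := {w | ∃ h : w ∈ ({x}ᶜ : Set V), (G.induce ({x}ᶜ : Set V)).Reachable u ⟨w, h⟩}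
  have hx : x ∉ A := fun ⟨h, _⟩ => h rfl
  have hA : ∀ a ∈ A, ∀ b, G.Adj a b → b ∈ A ∨ b = x := by
    rintro a ⟨ha, hr⟩ b hab
    by_cases hb : b = x
    · exact Or.inr hb
    · exact Or.inl ⟨hb, hr.trans (Adj.reachable (by simpa using hab))⟩
  have hu : (u : V) ∈ A := ⟨u.2, Reachable.refl _⟩
  have hv : (v : V) ∉ A := fun ⟨_, hr⟩ => huv hr
  refine ⟨A, hx, hA, ?_, ?_⟩
  · obtain ⟨d, -, h1, h2⟩ := p.exists_boundary_dart A hu hv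
    obtain h3 | h3 := hA _ h1 _ d.adj
    · exact absurd h3 h2
    · exact ⟨d.fst, h1, h3 ▸ d.adj.symm⟩
  · have hu' : (u : V) ∉ {w | w ∉ A ∧ w ≠ x} := fun h => h.1 hu
    obtain ⟨d, -, h1, h2⟩ := p.reverse.exists_boundary_dart {w | w ∉ A ∧ w ≠ x} ⟨hv, v.2⟩ hu'
    have h3 : d.snd = x := by
      by_contra h3
      have h4 : d.snd ∈ A := by
        by_contra h4
        exact h2 ⟨h4, h3⟩
      exact (hA _ h4 _ d.adj.symm).elim h1.1 h1.2
    exact ⟨d.fst, h1.1, h3 ▸ d.adj.symm⟩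

/-- A regular graph with a cut-vertex has degree at least three. -/
theorem IsRegularOfDegree.three_le_of_isCutVertex [Fintype V] [DecidableRel G.Adj] {k : ℕ}
    (hG : G.IsRegularOfDegree k) (h : G.IsCutVertex x) : 3 ≤ k := by
  classical
  obtain ⟨A, hx, hA, ⟨a, haA, hxa⟩, b, hbA, hxb⟩ := h.exists_separated_set
  have hab : a ≠ b := fun h => hbA (h ▸ haA)
  have hk : 2 ≤ k := by
    rw [← hG x, ← card_neighborFinset_eq_degree, ← Finset.card_pair hab]
    exact Finset.card_le_card (by simp [Finset.insert_subset_iff, hxa, hxb])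
  by_contra hk3
  obtain rfl : k = 2 := by omega
  -- In a 2-regular graph `xa` lies on a cycle. The rest of that cycle leaves `A` through a third
  -- neighbour of `x`.
  have hcyc : G.IsCycles := fun v _ => by
    rw [← hG v, ← card_neighborFinset_eq_degree, ← coe_neighborFinset, Set.ncard_coe_finset]
  obtain ⟨p⟩ := (hcyc.reachable_deleteEdges hxa).symm
  obtain ⟨d, -, h1, h2⟩ := p.exists_boundary_dart A haA hx
  have hd := d.adj
  rw [deleteEdges_adj] at hd
  obtain h3 | h3 := hA _ h1 _ hd.1
  · exact h2 h3
  rw [h3] at hd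
  have hca : d.fst ≠ a := fun h => hd.2 (by simp [h, Sym2.eq_swap])
  have hcb : d.fst ≠ b := fun h => hbA (h ▸ h1)
  have : ({d.fst, a, b} : Finset V).card ≤ 2 := by
    rw [← hG x, ← card_neighborFinset_eq_degree]
    exact Finset.card_le_card (by simp [Finset.insert_subset_iff, hxa, hxb, hd.1.symm])
  rw [Finset.card_eq_three.2 ⟨_, _, _, hca, hcb, hab, rfl⟩] at this
  omega

end Separation

/-! ### Faces passing repeatedly through a vertex. -/

namespace RotationSystem

variable {V : Type*} {G : SimpleGraph V} (R : G.RotationSystem)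

theorem facePerm_apply (d : G.Dart) : R.facePerm d = R.next d.symm := rfl

theorem fst_facePerm (d : G.Dart) : (R.facePerm d).fst = d.snd := R.fst_next d.symm

theorem face_eq_face_iff {d e : G.Dart} : R.face d = R.face e ↔ R.facePerm.SameCycle d e :=
  Quotient.eq

theorem face_facePerm (d : G.Dart) : R.face (R.facePerm d) = R.face d :=
  R.face_eq_face_iff.2 (Equiv.Perm.sameCycle_apply_left.2 (Equiv.Perm.SameCycle.refl _ _))

instance [Finite V] : Finite G.Dart :=
  Finite.of_injective _ (Dart.toProd_injective (G := G))

instance [Finite V] : Finite R.Face :=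
  Quotient.finite _

/-- The steps of the boundary walk of `F` that leave `x`. -/
def departures (F : R.Face) (x : V) : Set G.Dart := {d | R.face d = F ∧ d.fst = x}

theorem disjoint_departures_image_facePerm (F : R.Face) (x : V) :
    Disjoint (R.departures F x) (R.facePerm '' R.departures F x) := by
  rw [Set.disjoint_left]
  rintro _ ⟨-, h⟩ ⟨d, ⟨-, hd⟩, rfl⟩
  rw [fst_facePerm] at h
  exact d.adj.ne (hd.trans h.symm)

theorem two_mul_passes_le_length [Finite V] (F : R.Face) (x : V) :
    2 * R.passes F x ≤ R.length F := by
  have hsub : R.departures F x ∪ R.facePerm '' R.departures F x ⊆ {d | R.face d = F} := by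
    rintro _ (hd | ⟨d, hd, rfl⟩)
    · exact hd.1
    · exact (R.face_facePerm d).trans hd.1
  have h := Set.ncard_le_ncard hsub (Set.toFinite _)
  rw [Set.ncard_union_eq (R.disjoint_departures_image_facePerm F x),
    Set.ncard_image_of_injective _ R.facePerm.injective] at h
  rw [two_mul]
  exact h

/-- If the boundary walk of a face never returns to `x` after two steps, then any two of its passes
through `x` are at least three steps apart. -/
theorem three_mul_passes_le_length [Finite V] (F : R.Face) (x : V)
    (hF : ∀ d, R.face d = F → d.fst = x → (R.facePerm d).snd ≠ x) :
    3 * R.passes F x ≤ R.length F := by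
  set S := R.departures F x with hS
  have h1 := R.disjoint_departures_image_facePerm F x
  have h2 : Disjoint (S ∪ R.facePerm '' S) (R.facePerm '' (R.facePerm '' S)) := by
    rw [Set.disjoint_union_left]
    constructor
    · rw [Set.disjoint_left]
      rintro _ ⟨-, h⟩ ⟨_, ⟨d, hd, rfl⟩, rfl⟩
      rw [fst_facePerm] at h
      exact hF d hd.1 hd.2 h
    · exact (Set.disjoint_image_iff R.facePerm.injective).2 h1
  have hsub : S ∪ R.facePerm '' S ∪ R.facePerm '' (R.facePerm '' S) ⊆ {d | R.face d = F} := by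
    rintro _ ((hd | ⟨d, hd, rfl⟩) | ⟨_, ⟨d, hd, rfl⟩, rfl⟩)
    · exact hd.1
    · exact (R.face_facePerm d).trans hd.1
    · exact ((R.face_facePerm _).trans (R.face_facePerm d)).trans hd.1
  have h := Set.ncard_le_ncard hsub (Set.toFinite _)
  rw [Set.ncard_union_eq h2, Set.ncard_union_eq h1,
    Set.ncard_image_of_injective (R.facePerm '' S) R.facePerm.injective,
    Set.ncard_image_of_injective S R.facePerm.injective] at h
  calc 3 * R.passes F x = S.ncard + S.ncard + S.ncard := by
        rw [show R.passes F x = S.ncard from rfl]; ring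
    _ ≤ R.length F := h

/-- Around a cut-vertex, a step into one of the parts that it separates is followed in the rotation
by a step out of this part; the face between them passes through the cut-vertex twice. -/
theorem exists_two_le_passes [Finite V] {x : V} (hx : G.IsCutVertex x) :
    ∃ F : R.Face, 2 ≤ R.passes F x := by
  obtain ⟨A, hxA, hA, ⟨a, haA, hxa⟩, b, hbA, hxb⟩ := hx.exists_separated_set
  obtain ⟨d, hdx, hdA, hdA'⟩ : ∃ d : G.Dart, d.fst = x ∧ d.snd ∈ A ∧ (R.next d).snd ∉ A := by
    by_contra! hcon
    obtain ⟨n, hn⟩ := (R.sameCycle ⟨(x, a), hxa⟩ ⟨(x, b), hxb⟩ rfl).exists_nat_pow_eq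
    have key : ∀ m : ℕ, ((R.next ^ m) ⟨(x, a), hxa⟩).fst = x ∧
        ((R.next ^ m) ⟨(x, a), hxa⟩).snd ∈ A := by
      intro m
      induction m with
      | zero => exact ⟨rfl, haA⟩
      | succ m ih =>
        rw [pow_succ', Equiv.Perm.mul_apply]
        exact ⟨(R.fst_next _).trans ih.1, hcon _ ih.1 ih.2⟩
    have := (key n).2
    rw [hn] at this
    exact hbA this
  have hstep : R.facePerm d.symm = R.next d := by rw [facePerm_apply, Dart.symm_symm]
  refine ⟨R.face (R.next d), ?_⟩
  by_contra hlt
  -- With a single pass through `x`, the walk starting at `R.next d` could never enter `A`, yet it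
  -- contains `d.symm`, which starts in `A`.
  have huniq : ∀ e, R.face e = R.face (R.next d) → e.fst = x → e = R.next d := by
    intro e he hex
    have hle : (R.departures (R.face (R.next d)) x).ncard ≤ 1 := by
      change R.passes _ _ ≤ 1
      omega
    exact (Set.ncard_le_one (Set.toFinite _)).1 hle e ⟨he, hex⟩ _ ⟨rfl, (R.fst_next d).trans hdx⟩
  have key : ∀ m : ℕ, R.face ((R.facePerm ^ m) (R.next d)) = R.face (R.next d) ∧
      ((R.facePerm ^ m) (R.next d)).fst ∉ A ∧ ((R.facePerm ^ m) (R.next d)).snd ∉ A := by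
    intro m
    induction m with
    | zero => exact ⟨rfl, by simpa [R.fst_next, hdx] using hxA, hdA'⟩
    | succ m ih =>
      rw [pow_succ', Equiv.Perm.mul_apply]
      set e := (R.facePerm ^ m) (R.next d)
      have hface := (R.face_facePerm e).trans ih.1
      have hfst : (R.facePerm e).fst ∉ A := by rw [fst_facePerm]; exact ih.2.2
      refine ⟨hface, hfst, fun hs => ?_⟩
      obtain h | h := hA _ hs _ (R.facePerm e).adj.symm
      · exact hfst h
      · rw [huniq _ hface h] at hs
        exact hdA' hs
  have hsame : R.facePerm.SameCycle (R.next d) d.symm := by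
    rw [← R.face_eq_face_iff, ← hstep, face_facePerm]
  obtain ⟨n, hn⟩ := hsame.exists_nat_pow_eq
  have := (key n).2.1
  rw [hn] at this
  exact this hdA

/-- If a boundary walk turns around at the end of the dart `d`, then this end has degree one. -/
theorem degree_snd_eq_one [Fintype V] [DecidableRel G.Adj] {d : G.Dart}
    (hd : (R.facePerm d).snd = d.fst) : G.degree d.snd = 1 := by
  have hfix : R.next d.symm = d.symm :=
    Dart.ext _ _ (Prod.ext (R.fst_facePerm d) hd)
  rw [degree_eq_one_iff_existsUnique_adj]
  refine ⟨d.fst, d.adj.symm, fun y hy => ?_⟩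
  have h := (R.sameCycle d.symm ⟨(d.snd, y), hy⟩ rfl).eq_of_left hfix
  exact (congrArg (fun e : G.Dart => e.snd) h).symm

/-- Returning to `x` after two steps means turning around at a leaf; without leaves next to `x`, two
passes cost six steps. -/
theorem exists_degree_eq_one_of_isCutVertex [Fintype V] [DecidableRel G.Adj] {x : V}
    (hx : G.IsCutVertex x) (hF : ∀ F : R.Face, R.Incident F x → R.length F < 6) :
    ∃ y : V, G.Adj x y ∧ G.degree y = 1 := by
  obtain ⟨F, hpass⟩ := R.exists_two_le_passes hx
  have hinc : R.Incident F x :=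
    Set.nonempty_of_ncard_ne_zero (s := R.departures F x) (by change R.passes F x ≠ 0; omega)
  have hlen := hF F hinc
  by_contra! hcon
  have := R.three_mul_passes_le_length F x fun d _ hdx hs =>
    hcon d.snd (hdx ▸ d.adj) (R.degree_snd_eq_one (hs.trans hdx.symm))
  omega

/-! ### Euler's inequality and short faces. -/

section Euler

theorem crosses_symm {C : Set (Sym2 V)} {F F' : R.Face} (h : R.Crosses C F F') :
    R.Crosses C F' F := by
  obtain ⟨d, hd, h1, h2⟩ := h
  exact ⟨d.symm, by rwa [Dart.edge_symm], h2, by rwa [Dart.symm_symm]⟩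

variable {R}

/-- In a plane drawing, the edge of a dart `d` outside a spanning tree `T` separates its two sides
in the dual graph consisting of all edges outside `T`. -/
theorem IsPlane.not_reflTransGen_crosses (hR : R.IsPlane) {T : SimpleGraph V} (hTG : T ≤ G)
    (hT : T.Connected) {d : G.Dart} (hd : d.edge ∉ T.edgeSet) :
    ¬ Relation.ReflTransGen (R.Crosses (T.edgeSet ∪ {d.edge})) (R.face d) (R.face d.symm) := by
  classical
  -- The tree path closed up by `d` is a cycle inside `T ∪ {d.edge}`.
  obtain ⟨p, hp⟩ := (hT d.snd d.fst).exists_isPath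
  let q := p.mapLe hTG
  have hq : q.IsPath := (Walk.isPath_mapLe hTG).2 hp
  have hqT : ∀ e ∈ q.edges, e ∈ T.edgeSet := fun e he => by
    rw [Walk.edges_mapLe_eq_edges] at he
    exact p.edges_subset_edgeSet he
  have hc : (Walk.cons d.adj q).IsCycle :=
    (Walk.cons_isCycle_iff _ _).2 ⟨hq, fun h => hd (hqT _ h)⟩
  intro h
  refine hR _ _ hc d (by simp) (Relation.ReflTransGen.mono ?_ _ _ h)
  rintro F F' ⟨e, he, h1⟩
  refine ⟨e, fun hmem => he ?_, h1⟩
  rw [Set.mem_ofPred_eq, Walk.edges_cons, List.mem_cons] at hmem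
  obtain hmem | hmem := hmem
  · exact Or.inr hmem
  · exact Or.inl (hqT _ hmem)

/-- The part of Euler's formula used here: a connected plane graph has at least as many faces as
its cycle rank. -/
theorem IsPlane.card_edges_add_one_le [Fintype V] [DecidableRel G.Adj] (hR : R.IsPlane)
    (hG : G.Connected) : G.edgeFinset.card + 1 ≤ Fintype.card V + Nat.card R.Face := by
  classical
  have := Fintype.ofFinite R.Face
  obtain ⟨T, hTG, hT⟩ := hG.exists_isTree_le
  let S := G.edgeFinset \ T.edgeFinset
  have hcard : S.card + T.edgeFinset.card = G.edgeFinset.card :=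
    Finset.card_sdiff_add_card_eq_card (edgeFinset_mono hTG)
  have hdart : ∀ e : S, ∃ d : G.Dart, d.edge = e := by
    rintro ⟨e, he⟩
    have heG : e ∈ G.edgeSet := mem_edgeFinset.1 (Finset.mem_sdiff.1 he).1
    induction e with
    | _ u v => exact ⟨⟨(u, v), heG⟩, rfl⟩
  choose δ hδ using hdart
  have hδT : ∀ e : S, (δ e).edge ∉ T.edgeSet := fun e h => by
    rw [hδ] at h
    exact (Finset.mem_sdiff.1 e.2).2 (mem_edgeFinset.2 h)
  let side (e : S) : Set R.Face :=
    {F | Relation.ReflTransGen (R.Crosses (T.edgeSet ∪ {(δ e).edge})) (R.face (δ e)) F}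
  -- `φ e` sums over one side of `e`. Any other non-tree edge has both its faces on the same side,
  -- so the `φ e` are dual to the `v e`, which are thus independent: there are at most as many
  -- non-tree edges as faces.
  let φ (e : S) : Module.Dual ℚ (R.Face → ℚ) :=
    ∑ F : R.Face with F ∈ side e, LinearMap.proj F
  let v (e : S) : R.Face → ℚ :=
    Pi.single (R.face (δ e)) 1 - Pi.single (R.face (δ e).symm) 1
  have hφ : ∀ e e', φ e (v e') = (if R.face (δ e') ∈ side e then (1 : ℚ) else 0) -
      if R.face (δ e').symm ∈ side e then (1 : ℚ) else 0 := by
    intro e e'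
    simp only [φ, v, LinearMap.sum_apply, LinearMap.proj_apply, Pi.sub_apply, Pi.single_apply,
      Finset.sum_sub_distrib, Finset.sum_ite_eq', Finset.mem_filter_univ]
  have hli : LinearIndependent ℚ v := by
    refine LinearIndependent.of_pairwise_dual_eq_zero_one v φ ?_ ?_
    · intro e e' hne
      have hcross : R.Crosses (T.edgeSet ∪ {(δ e).edge}) (R.face (δ e')) (R.face (δ e').symm) := by
        refine ⟨δ e', ?_, rfl, rfl⟩
        rintro (h | h)
        · exact hδT e' h
        · rw [Set.mem_singleton_iff, hδ, hδ] at h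
          exact hne (Subtype.ext h.symm)
      have hiff : R.face (δ e') ∈ side e ↔ R.face (δ e').symm ∈ side e :=
        ⟨fun h => h.tail hcross, fun h => h.tail (R.crosses_symm hcross)⟩
      simp only [hφ, hiff, sub_self]
    · intro e
      have h1 : R.face (δ e) ∈ side e := Relation.ReflTransGen.refl
      have h2 : R.face (δ e).symm ∉ side e := hR.not_reflTransGen_crosses hTG hT.connected (hδT e)
      rw [hφ, if_pos h1, if_neg h2, sub_zero]
  have hle := hli.fintype_card_le_finrank
  rw [Module.finrank_fintype_fun_eq_card, Fintype.card_coe] at hle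
  have := hT.card_edgeFinset
  rw [Nat.card_eq_fintype_card]
  omega

variable (R)

theorem sum_length [Fintype V] [DecidableRel G.Adj] [Fintype R.Face] :
    ∑ F : R.Face, R.length F = 2 * G.edgeFinset.card := by
  classical
  rw [← dart_card_eq_twice_card_edges, ← Finset.card_univ,
    Finset.card_eq_sum_card_fiberwise (f := R.face) (t := Finset.univ) (by simp)]
  refine Finset.sum_congr rfl fun F _ => ?_
  rw [length, ← Set.ncard_coe_finset]
  simp

theorem length_pos [Finite V] (F : R.Face) : 0 < R.length F := by
  obtain ⟨d, rfl⟩ := Quotient.exists_rep F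
  exact (Set.ncard_pos (Set.toFinite _)).2 ⟨d, rfl⟩

variable {R}

/-- In a connected plane graph of minimum degree at least three, some face other than `F₀` has length
less than six. -/
theorem IsPlane.exists_length_lt_six [Fintype V] [DecidableRel G.Adj] (hR : R.IsPlane)
    (hG : G.Connected) (hdeg : ∀ v, 3 ≤ G.degree v) (F₀ : R.Face) :
    ∃ F ≠ F₀, R.length F < 6 := by
  classical
  have := Fintype.ofFinite R.Face
  by_contra! hcon
  have hE := hR.card_edges_add_one_le hG
  have hsum := R.sum_length
  have hdegsum := G.sum_degrees_eq_twice_card_edges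
  have h3 : Fintype.card V * 3 ≤ ∑ v, G.degree v := by
    simpa using Finset.card_nsmul_le_sum Finset.univ (fun v => G.degree v) 3 fun v _ => hdeg v
  have h6 : (Finset.univ.erase F₀).card * 6 ≤ ∑ F ∈ Finset.univ.erase F₀, R.length F := by
    simpa using Finset.card_nsmul_le_sum (Finset.univ.erase F₀) R.length 6
      fun F hF => hcon F (Finset.ne_of_mem_erase hF)
  rw [← Finset.add_sum_erase _ _ (Finset.mem_univ F₀)] at hsum
  rw [Finset.card_erase_of_mem (Finset.mem_univ _), Finset.card_univ] at h6
  rw [Nat.card_eq_fintype_card] at hE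
  -- The first two bounds give 2E + 6 ≤ 6F, while 6(F - 1) plus the length of `F₀` is at most 2E:
  -- positivity of that length is just enough.
  have hpos := R.length_pos F₀
  have hF : 0 < Fintype.card R.Face := Fintype.card_pos_iff.2 ⟨F₀⟩
  omega

end Euler

end RotationSystem

end SimpleGraph

open SimpleGraph in
theorem mainTheorem5 {V : Type*} [Fintype V] (G : SimpleGraph V) [DecidableRel G.Adj]
    (R : G.RotationSystem) :
    (G.Connected → R.IsPlane → ∀ x : V, G.IsCutVertex x →
      (∃ F : R.Face, 2 ≤ R.passes F x ∧ 4 ≤ R.length F) ∧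
      ((∀ F : R.Face, R.Incident F x → R.length F < 6) →
        ∃ y : V, G.Adj x y ∧ G.degree y = 1)) ∧
    (∀ (k d : ℕ) (F₀ : R.Face), R.IsNearlyPlatonic k d 1 → R.length F₀ ≠ d →
      (∃ x : V, G.IsCutVertex x) →
        6 ≤ R.length F₀ ∧ ∀ x : V, G.IsCutVertex x → R.Incident F₀ x) := by
  refine ⟨fun _ _ x hx => ⟨?_, R.exists_degree_eq_one_of_isCutVertex hx⟩, ?_⟩
  · obtain ⟨F, hF⟩ := R.exists_two_le_passes hx
    exact ⟨F, hF, by have := R.two_mul_passes_le_length F x; omega⟩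
  · rintro k d F₀ ⟨hG, hR, hreg, hexc⟩ hF₀ ⟨x₀, hx₀⟩
    have hk := hreg.three_le_of_isCutVertex hx₀
    have huniq : ∀ F, F ≠ F₀ → R.length F = d := by
      intro F hne
      by_contra hF
      exact hne ((Set.ncard_le_one (Set.toFinite _)).1 hexc.le F hF F₀ hF₀)
    obtain ⟨F₁, hF₁, hlt⟩ := hR.exists_length_lt_six hG (fun v => (hreg v).symm ▸ hk) F₀
    rw [huniq F₁ hF₁] at hlt
    have key : ∀ x, G.IsCutVertex x → R.Incident F₀ x ∧ 6 ≤ R.length F₀ := by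
      intro x hx
      by_contra hcon
      -- Otherwise all faces at `x` are shorter than 6, producing a leaf, against `3 ≤ k`.
      obtain ⟨y, -, hy⟩ := R.exists_degree_eq_one_of_isCutVertex hx fun F hF => by
        by_cases h : F = F₀
        · subst h
          by_contra h6
          exact hcon ⟨hF, by omega⟩
        · rwa [huniq F h]
      rw [hreg y] at hy
      omega
    exact ⟨(key x₀ hx₀).2, fun x hx => (key x hx).1⟩
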